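/- For a set $X$, a transfinite word on $X$ is a map $w$ from an ordinal $|w|$ (its length, identified with the set of smaller ordinals) to $X$. The concatenation $ww'$ is the word of length $|w|+|w'|$ that reads $w$ and then $w'$, and $AB=\{ww' : w\in A,\ w'\in B\}$ for sets $A,B$ of words. For $F\subseteq X$ and an ordinal $\gamma$, $F^{<\gamma}$ is the set of words of length $<\gamma$ all of whose letters are in $F$; in particular $X^{<\alpha}$ is the set of all words on $X$ of length $<\alpha$. If $X$ is a topological space, the regular subword topology on $X^{<\alpha}$ is the coarsest topology in which all the sets $(F_1^{<\alpha_1}F_2^{<\alpha_2}\cdots F_n^{<\alpha_n})\cap X^{<\alpha}$ are closed, where $n\in\mathbb N$ (the empty product being the set consisting of the empty word), $F_1,\dots,F_n$ are closed subsets of $X$ and $\alpha_1,\dots,\alpha_n$ are arbitrary ordinals. A bound is an ordinal of the form $\omega^\beta$ or $\omega^\beta+1$, where $\beta\ge 0$ is an ordinal. **Proposition.** Let $X$ be a Noetherian topological space (every open subset is compact) and let $\alpha$ be a bound. Call a topology $\tau$ on $X^{<\alpha}$ admissible if 1. $F^{<\gamma}$ is $\tau$-closed for every closed subset $F$ of $X$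 and every ordinal $\gamma\le\alpha$; and 2. $\mathcal C_1\mathcal C_2$ is $\tau$-closed for all $\tau$-closed subsets $\mathcal C_1,\mathcal C_2$ of $X^{<\alpha}$ such that $\mathcal C_1\mathcal C_2\subseteq X^{<\alpha}$. Then the regular subword topology on $X^{<\alpha}$ is the coarsest admissible topology: it is admissible, and every admissible topology on $X^{<\alpha}$ is finer than or equal to it. -/

import Mathlib

universe u v

/-- A transfinite word on `X`: a map from (the set of ordinals strictly below) an ordinal to `X`. -/
structure TransWord (X : Type u) : Type (max u (v + 1)) where
  length : Ordinal.{v}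
  letter : Set.Iio length → X

namespace TransWord

open scoped Topology

variable {X : Type u}

/-- Concatenation: the word of length `|w| + |w'|` that reads `w` and then `w'`. -/
noncomputable def cat (w w' : TransWord.{u, v} X) : TransWord.{u, v} X where
  length := w.length + w'.length
  letter := fun β =>
    if h : β.1 < w.length then w.letter ⟨β.1, h⟩
    else w'.letter ⟨β.1 - w.length, Ordinal.sub_lt_of_le (not_lt.mp h) |>.mpr β.2⟩

/-- The empty word. -/
def empty : TransWord.{u, v} X where
  length := 0
  letter := fun β => absurd β.2 (not_lt.mpr (zero_le (a := β.1)))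

/-- `AB`, the set of all concatenations of a word in `A` with a word in `B`. -/
def catSet (A B : Set (TransWord.{u, v} X)) : Set (TransWord.{u, v} X) :=
  {w | ∃ a ∈ A, ∃ b ∈ B, w = cat a b}

/-- `F^{<γ}`, the set of words of length `< γ` all of whose letters lie in `F`. -/
def powLT (F : Set X) (γ : Ordinal.{v}) : Set (TransWord.{u, v} X) :=
  {w | w.length < γ ∧ ∀ β, w.letter β ∈ F}

/-- The product `F₁^{<α₁} ⋯ Fₙ^{<αₙ}`; for `n = 0` it consists of the empty word only. -/
def listProd : List (Set X × Ordinal.{v}) → Set (TransWord.{u, v} X)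
  | [] => {empty}
  | p :: L => catSet (powLT p.1 p.2) (listProd L)

/-- `X^{<α}`, the set of words of length `< α`. -/
def wordsLT (X : Type u) (α : Ordinal.{v}) : Set (TransWord.{u, v} X) :=
  {w | w.length < α}

/-- The regular subword topology on a set `Y` of transfinite words: the coarsest topology in which
all sets `(F₁^{<α₁} ⋯ Fₙ^{<αₙ}) ∩ Y` are closed, with `Fᵢ` closed in `X` and `αᵢ` an ordinal. -/
abbrev regularSubwordTopology [TopologicalSpace X] (Y : Set (TransWord.{u, v} X)) :
    TopologicalSpace Y :=
  TopologicalSpace.generateFrom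
    {U | ∃ L : List (Set X × Ordinal.{v}), (∀ p ∈ L, IsClosed p.1) ∧
      U = ((Subtype.val : Y → TransWord.{u, v} X) ⁻¹' listProd L)ᶜ}

/-- A bound is an ordinal of the form `ω ^ β` or `ω ^ β + 1`. -/
def IsBound (α : Ordinal.{v}) : Prop :=
  ∃ β : Ordinal.{v}, α = Ordinal.omega0 ^ β ∨ α = Ordinal.omega0 ^ β + 1

/-- A topology `τ` on `X^{<α}` is admissible if `F^{<γ}` is `τ`-closed for all closed `F` and all
`γ ≤ α`, and `C₁C₂` is `τ`-closed for all `τ`-closed `C₁`, `C₂` with `C₁C₂ ⊆ X^{<α}`. -/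
structure IsAdmissible [TopologicalSpace X] (α : Ordinal.{v})
    (τ : TopologicalSpace (wordsLT.{u, v} X α)) : Prop where
  isClosed_powLT : ∀ (F : Set X) (γ : Ordinal.{v}), IsClosed F → γ ≤ α →
    IsClosed[τ] ((Subtype.val : wordsLT.{u, v} X α → TransWord.{u, v} X) ⁻¹' powLT F γ)
  isClosed_catSet : ∀ C₁ C₂ : Set (wordsLT.{u, v} X α), IsClosed[τ] C₁ → IsClosed[τ] C₂ →
    catSet (Subtype.val '' C₁) (Subtype.val '' C₂) ⊆ wordsLT.{u, v} X α →
    IsClosed[τ] ((Subtype.val : wordsLT.{u, v} X α → TransWord.{u, v} X) ⁻¹'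
      catSet (Subtype.val '' C₁) (Subtype.val '' C₂))

end TransWord

namespace TransWord

open Ordinal
open scoped Topology

variable {X : Type u}

/-! Closure of `C₁C₂`: suppose every cut of `w` has its prefix outside `C₁` or its suffix outside
`C₂`. Let `a` be the first cut whose prefix is outside `C₁`. Products are closed under prefixes, so
finitely many products covering `C₁` and missing that prefix miss the prefixes of all cuts from `a`
on. For cuts before `a` the suffixes are outside `C₂`, and one suffix controls all of them
(`exists_stable_suffix`): this is where Noetherianity enters. Concatenating the two finite families
covers `C₁C₂` and misses `w`. Coarsest: induct on the number of factors. Shortening the first factor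
to length below the relevant power of `ω` makes condition 2 applicable; the words lost have nothing
after their first factor. -/

theorem ext_letter {w w' : TransWord.{u, v} X} (h : w.length = w'.length)
    (h' : ∀ β (hβ : β < w.length) (hβ' : β < w'.length), w.letter ⟨β, hβ⟩ = w'.letter ⟨β, hβ'⟩) :
    w = w' := by
  obtain ⟨l, f⟩ := w
  obtain ⟨l', f'⟩ := w'
  obtain rfl : l = l' := h
  congr 1
  funext β
  exact h' β.1 β.2 β.2

theorem letter_congr (w : TransWord.{u, v} X) {β γ : Ordinal.{v}} (h : β = γ)
    (hβ : β < w.length) (hγ : γ < w.length) : w.letter ⟨β, hβ⟩ = w.letter ⟨γ, hγ⟩ := by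
  subst h; rfl

/-- The factor of `w` formed by the letters at the positions in `[p, q)`. -/
noncomputable def slice (w : TransWord.{u, v} X) (p q : Ordinal.{v}) (hq : q ≤ w.length) :
    TransWord.{u, v} X where
  length := q - p
  letter := fun β => w.letter ⟨p + β.1, (Ordinal.lt_sub.mp β.2).trans_le hq⟩

theorem slice_self (w : TransWord.{u, v} X) (p : Ordinal.{v}) (hp : p ≤ w.length) :
    slice w p p hp = empty := by
  refine ext_letter (Ordinal.sub_self p) fun β _ hβ => absurd hβ (not_lt.mpr (zero_le (a := β)))

theorem slice_zero_length (w : TransWord.{u, v} X) : slice w 0 w.length le_rfl = w := by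
  refine ext_letter (Ordinal.sub_zero _) fun β _ hβ => ?_
  exact letter_congr w (zero_add β) _ _

theorem cat_slice (w : TransWord.{u, v} X) {p r q : Ordinal.{v}} (hpr : p ≤ r) (hrq : r ≤ q)
    (hq : q ≤ w.length) :
    cat (slice w p r (hrq.trans hq)) (slice w r q hq) = slice w p q hq := by
  have hlen : (r - p) + (q - r) = q - p := by
    rw [eq_comm]
    apply Ordinal.sub_eq_of_add_eq
    rw [← add_assoc, Ordinal.add_sub_cancel_of_le hpr, Ordinal.add_sub_cancel_of_le hrq]
  refine ext_letter hlen fun β _ hβ' => ?_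
  by_cases hβ : β < r - p
  · exact dif_pos hβ
  · refine (dif_neg hβ).trans (letter_congr w ?_ _ _)
    change r + (β - (r - p)) = p + β
    conv_rhs => rw [← Ordinal.add_sub_cancel_of_le (not_lt.mp hβ), ← add_assoc,
      Ordinal.add_sub_cancel_of_le hpr]

theorem slice_cat_left (a b : TransWord.{u, v} X) (h : a.length ≤ (cat a b).length) :
    slice (cat a b) 0 a.length h = a := by
  refine ext_letter (Ordinal.sub_zero _) fun β _ hβ => ?_
  refine (letter_congr (cat a b) (zero_add β) _ (hβ.trans_le h)).trans ?_
  exact dif_pos hβ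

theorem slice_cat_right (a b : TransWord.{u, v} X) :
    slice (cat a b) a.length (cat a b).length le_rfl = b := by
  refine ext_letter (Ordinal.add_sub_cancel _ _) fun β _ hβ => ?_
  refine (dif_neg (not_lt.mpr le_self_add)).trans ?_
  exact letter_congr b (Ordinal.add_sub_cancel _ _) _ _

theorem slice_slice (w : TransWord.{u, v} X) {p q s t : Ordinal.{v}} (hq : q ≤ w.length)
    (ht : t ≤ (slice w p q hq).length) (ht' : p + t ≤ w.length) :
    slice (slice w p q hq) s t ht = slice w (p + s) (p + t) ht' :=
  ext_letter (Ordinal.add_sub_add_cancel _ _ _).symm fun _ _ _ =>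
    letter_congr w (add_assoc _ _ _).symm _ _

/-- Factorisations become cut points of one fixed word, so later inductions only compare ordinals.
-/
theorem slice_mem_catSet {A B : Set (TransWord.{u, v} X)} {w : TransWord.{u, v} X}
    {p q : Ordinal.{v}} (hpq : p ≤ q) (hq : q ≤ w.length) :
    slice w p q hq ∈ catSet A B ↔ ∃ (r : Ordinal.{v}) (_ : p ≤ r) (hrq : r ≤ q),
      slice w p r (hrq.trans hq) ∈ A ∧ slice w r q hq ∈ B := by
  constructor
  · rintro ⟨a, ha, b, hb, hab⟩
    have hl : (slice w p q hq).length = a.length + b.length := congrArg length hab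
    have hq' : p + (slice w p q hq).length = q := Ordinal.add_sub_cancel_of_le hpq
    have hle : a.length ≤ (slice w p q hq).length := hl ▸ le_self_add
    have hrq : p + a.length ≤ q := (add_le_add_right hle p).trans_eq hq'
    refine ⟨p + a.length, le_self_add, hrq, ?_, ?_⟩
    · have h := slice_slice w (s := 0) hq hle (hrq.trans hq)
      simp only [add_zero] at h
      rw [← h]
      have h2 := slice_cat_left a b le_self_add
      simp only [← hab] at h2
      rwa [h2]
    · have h := slice_slice w (s := a.length) hq le_rfl (hq'.trans_le hq)
      simp only [hq'] at h
      rw [← h]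
      have h2 := slice_cat_right a b
      simp only [← hab] at h2
      rwa [h2]
  · rintro ⟨r, hpr, hrq, ha, hb⟩
    exact ⟨_, ha, _, hb, (cat_slice w hpr hrq hq).symm⟩

theorem slice_mem_powLT {F : Set X} {γ : Ordinal.{v}} {w : TransWord.{u, v} X}
    {p q : Ordinal.{v}} (hq : q ≤ w.length) :
    slice w p q hq ∈ powLT F γ ↔
      q - p < γ ∧ ∀ β (hβ : β < q), p ≤ β → w.letter ⟨β, hβ.trans_le hq⟩ ∈ F := by
  refine and_congr Iff.rfl ⟨fun h β hβ hpβ => ?_, fun h β => ?_⟩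
  · have h1 := Ordinal.add_sub_cancel_of_le hpβ
    have h2 := h ⟨β - p, Ordinal.lt_sub.mpr (h1.trans_lt hβ)⟩
    exact letter_congr w h1 _ (hβ.trans_le hq) ▸ h2
  · exact h _ (Ordinal.lt_sub.mp β.2) le_self_add

theorem empty_mem_powLT (F : Set X) {γ : Ordinal.{v}} (hγ : 0 < γ) :
    (empty : TransWord.{u, v} X) ∈ powLT F γ :=
  ⟨hγ, fun β => absurd β.2 (not_lt.mpr (zero_le (a := β.1)))⟩

theorem eq_empty_of_length_eq_zero {w : TransWord.{u, v} X} (h : w.length = 0) : w = empty :=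
  ext_letter h fun β _ hβ => absurd hβ (not_lt.mpr (zero_le (a := β)))

/-! ### Products are closed under prefixes and suffixes -/

theorem slice_mem_listProd_cons {F : Set X} {γ : Ordinal.{v}} {L : List (Set X × Ordinal.{v})}
    {w : TransWord.{u, v} X} {p q : Ordinal.{v}} (hpq : p ≤ q) (hq : q ≤ w.length) :
    slice w p q hq ∈ listProd ((F, γ) :: L) ↔ ∃ (r : Ordinal.{v}) (_ : p ≤ r) (hrq : r ≤ q),
      (r - p < γ ∧ ∀ β (hβ : β < r), p ≤ β →
        w.letter ⟨β, hβ.trans_le (hrq.trans hq)⟩ ∈ F) ∧ slice w r q hq ∈ listProd L := by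
  simp only [listProd, slice_mem_catSet hpq hq, slice_mem_powLT]

theorem slice_mem_listProd_of_right_le {w : TransWord.{u, v} X}
    (L : List (Set X × Ordinal.{v})) {p q q' : Ordinal.{v}} (hpq : p ≤ q') (hqq : q' ≤ q)
    (hq : q ≤ w.length) (h : slice w p q hq ∈ listProd L) :
    slice w p q' (hqq.trans hq) ∈ listProd L := by
  induction L generalizing p q' with
  | nil =>
    have h0 : q - p = 0 := congrArg length (show slice w p q hq = empty from h)
    obtain rfl : q' = p := le_antisymm (hqq.trans (Ordinal.sub_eq_zero_iff_le.mp h0)) hpq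
    exact slice_self w _ _
  | cons P L ih =>
    obtain ⟨F, γ⟩ := P
    rw [slice_mem_listProd_cons (hpq.trans hqq)] at h
    rw [slice_mem_listProd_cons hpq]
    obtain ⟨r, hpr, hrq, ⟨hlt, hF⟩, hL⟩ := h
    rcases le_total r q' with hr | hr
    · exact ⟨r, hpr, hr, ⟨hlt, hF⟩, ih hr hqq hL⟩
    · refine ⟨q', hpq, le_rfl, ⟨?_, fun β hβ => hF β (hβ.trans_le hr)⟩, ?_⟩
      · refine lt_of_le_of_lt ?_ hlt
        rw [Ordinal.sub_le, Ordinal.add_sub_cancel_of_le hpr]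
        exact hr
      · have := ih le_rfl hrq hL
        rwa [slice_self] at this ⊢

theorem slice_mem_listProd_of_le_left {w : TransWord.{u, v} X}
    (L : List (Set X × Ordinal.{v})) {p p' q : Ordinal.{v}} (hpp : p ≤ p') (hpq : p' ≤ q)
    (hq : q ≤ w.length) (h : slice w p q hq ∈ listProd L) :
    slice w p' q hq ∈ listProd L := by
  induction L generalizing p with
  | nil =>
    have h0 : q - p = 0 := congrArg length (show slice w p q hq = empty from h)
    obtain rfl : p' = q := le_antisymm hpq ((Ordinal.sub_eq_zero_iff_le.mp h0).trans hpp)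
    exact slice_self w _ _
  | cons P L ih =>
    obtain ⟨F, γ⟩ := P
    rw [slice_mem_listProd_cons (hpp.trans hpq)] at h
    rw [slice_mem_listProd_cons hpq]
    obtain ⟨r, hpr, hrq, ⟨hlt, hF⟩, hL⟩ := h
    rcases le_total p' r with hr | hr
    · refine ⟨r, hr, hrq, ⟨?_, fun β hβ hβ' => hF β hβ (hpp.trans hβ')⟩, hL⟩
      refine lt_of_le_of_lt ?_ hlt
      rw [Ordinal.sub_le]
      calc r = p + (r - p) := (Ordinal.add_sub_cancel_of_le hpr).symm
        _ ≤ p' + (r - p) := add_le_add_left hpp _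
    · refine ⟨p', le_rfl, hpq, ⟨?_, fun β hβ hβ' => absurd hβ (not_lt.mpr hβ')⟩, ih hr hL⟩
      rw [Ordinal.sub_self]
      exact bot_le.trans_lt hlt

theorem slice_mem_listProd_append {w : TransWord.{u, v} X}
    (L M : List (Set X × Ordinal.{v})) {p q : Ordinal.{v}} (hpq : p ≤ q) (hq : q ≤ w.length) :
    slice w p q hq ∈ listProd (L ++ M) ↔ ∃ (r : Ordinal.{v}) (_ : p ≤ r) (hrq : r ≤ q),
      slice w p r (hrq.trans hq) ∈ listProd L ∧ slice w r q hq ∈ listProd M := by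
  induction L generalizing p with
  | nil =>
    constructor
    · intro h
      exact ⟨p, le_rfl, hpq, slice_self w _ _, h⟩
    · rintro ⟨r, hpr, hrq, h, h'⟩
      have h0 : r - p = 0 := congrArg length (show slice w p r (hrq.trans hq) = empty from h)
      obtain rfl : r = p := le_antisymm (Ordinal.sub_eq_zero_iff_le.mp h0) hpr
      exact h'
  | cons P L ih =>
    obtain ⟨F, γ⟩ := P
    rw [List.cons_append, slice_mem_listProd_cons hpq]
    constructor
    · rintro ⟨s, hps, hsq, hF, h⟩
      obtain ⟨r, hsr, hrq, hL, hM⟩ := (ih hsq).mp h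
      exact ⟨r, hps.trans hsr, hrq,
        (slice_mem_listProd_cons (hps.trans hsr) _).mpr ⟨s, hps, hsr, hF, hL⟩, hM⟩
    · rintro ⟨r, hpr, hrq, hL, hM⟩
      obtain ⟨s, hps, hsr, hF, h⟩ := (slice_mem_listProd_cons hpr _).mp hL
      exact ⟨s, hps, hsr.trans hrq, hF, (ih (hsr.trans hrq)).mpr ⟨r, hsr, hrq, h, hM⟩⟩

/-! ### Stabilisation of suffixes -/

/-- Over a Noetherian space, the suffixes of a word that start just before a given limit position
all lie in the same products. -/
theorem exists_stable_suffix_of_isSuccLimit [TopologicalSpace X]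
    [TopologicalSpace.NoetherianSpace X] (w : TransWord.{u, v} X) {a : Ordinal.{v}}
    (ha : a ≤ w.length) (hlim : Order.IsSuccLimit a) :
    ∃ p < a, ∀ q, p ≤ q → q < a → ∀ L : List (Set X × Ordinal.{v}), (∀ P ∈ L, IsClosed P.1) →
      slice w q w.length le_rfl ∈ listProd L → slice w p w.length le_rfl ∈ listProd L := by
  have h0 : 0 < a := bot_lt_iff_ne_bot.mpr hlim.ne_bot
  let S : Ordinal.{v} → Set X := fun p => {x | ∃ β, ∃ hβ : β < a, p ≤ β ∧
    w.letter ⟨β, hβ.trans_le ha⟩ = x}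
  let C : Ordinal.{v} → TopologicalSpace.Closeds X := fun p => TopologicalSpace.Closeds.closure (S p)
  have hS : ∀ {p q}, p ≤ q → S q ⊆ S p := fun hpq x ⟨β, hβ, hqβ, hx⟩ => ⟨β, hβ, hpq.trans hqβ, hx⟩
  have hC : ∀ {p q}, p ≤ q → C q ≤ C p := fun hpq => closure_mono (hS hpq)
  -- As `p` grows towards `a`, both the closure of the letters in `[p, a)` and the remainder `a - p`
  -- decrease; from `p₀`, resp. `p₁`, on they are constant.
  obtain ⟨_, ⟨p₀, hp₀, rfl⟩, hmin₀⟩ := wellFounded_lt.has_min (C '' Set.Iio a) ⟨_, 0, h0, rfl⟩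
  obtain ⟨_, ⟨p₁, hp₁, rfl⟩, hmin₁⟩ :=
    wellFounded_lt.has_min ((fun p => a - p) '' Set.Iio a) ⟨_, 0, h0, rfl⟩
  have hCeq : ∀ q, p₀ ≤ q → q < a → C p₀ ≤ C q := fun q hq hqa =>
    (eq_of_le_of_not_lt (hC hq) (hmin₀ _ ⟨q, hqa, rfl⟩)).ge
  have hleq : ∀ q, q < a → a - p₁ ≤ a - q := fun q hqa => not_lt.mp (hmin₁ _ ⟨q, hqa, rfl⟩)
  refine ⟨max p₀ p₁, max_lt hp₀ hp₁, fun q hpq hqa L hL h => ?_⟩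
  set p := max p₀ p₁
  have hpa : p < a := max_lt hp₀ hp₁
  induction L generalizing q with
  | nil =>
    have h1 : w.length - q = 0 := congrArg length (show slice w q w.length le_rfl = empty from h)
    exact absurd (ha.trans (Ordinal.sub_eq_zero_iff_le.mp h1)) (not_le.mpr hqa)
  | cons P L ih =>
    obtain ⟨F, γ⟩ := P
    rw [slice_mem_listProd_cons (hqa.le.trans ha)] at h
    rw [slice_mem_listProd_cons (hpa.le.trans ha)]
    obtain ⟨r, hqr, hrn, ⟨hlt, hF⟩, hr⟩ := h
    have hFc : IsClosed F := hL _ List.mem_cons_self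
    rcases lt_or_ge r a with hra | har
    -- The first factor ends before `a`: let it match the empty word and recurse from `r`.
    · refine ⟨p, le_rfl, hpa.le.trans ha, ⟨?_, fun β hβ hβ' => absurd hβ (not_lt.mpr hβ')⟩,
        ih r hra (fun P hP => hL P (List.mem_cons_of_mem _ hP)) hr (hpq.trans hqr)⟩
      rw [Ordinal.sub_self]
      exact bot_le.trans_lt hlt
    · refine ⟨r, hpa.le.trans har, hrn, ⟨lt_of_le_of_lt ?_ hlt, fun β hβ hpβ => ?_⟩, hr⟩
      · rw [Ordinal.sub_le]
        -- Starting at `p` instead of `q` does not lengthen the factor, because the remainders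
        -- agree.
        have h1 : a - p ≤ a - q := by
          refine le_trans ?_ (hleq q hqa)
          rw [Ordinal.sub_le]
          calc a = p₁ + (a - p₁) := (Ordinal.add_sub_cancel_of_le (le_of_lt hp₁)).symm
            _ ≤ p + (a - p₁) := add_le_add_left (le_max_right _ _) _
        calc r = p + (a - p) + (r - a) := by
              rw [Ordinal.add_sub_cancel_of_le hpa.le, Ordinal.add_sub_cancel_of_le har]
          _ ≤ p + (a - q) + (r - a) := by gcongr
          _ = p + (r - q) := by
              rw [add_assoc]
              congr 1
              rw [eq_comm]
              apply Ordinal.sub_eq_of_add_eq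
              rw [← add_assoc, Ordinal.add_sub_cancel_of_le hqa.le,
                Ordinal.add_sub_cancel_of_le har]
      · rcases lt_or_ge β a with hβa | hβa
        · have hsub : S q ⊆ F := by
            rintro x ⟨δ, hδ, hqδ, rfl⟩
            exact hF δ (hδ.trans_le har) hqδ
          have h1 : w.letter ⟨β, hβa.trans_le ha⟩ ∈ (C p : Set X) :=
            subset_closure ⟨β, hβa, hpβ, rfl⟩
          have h2 : C p ≤ C q :=
            (hC (le_max_left _ _)).trans (hCeq q ((le_max_left _ _).trans hpq) hqa)
          exact closure_minimal hsub hFc (h2 h1)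
        · exact hF β hβ (hqa.le.trans hβa)

/-- If `a` is a successor, the suffix at its predecessor is the shortest one in play and suffix
closure suffices; limits need the previous lemma. -/
theorem exists_stable_suffix [TopologicalSpace X] [TopologicalSpace.NoetherianSpace X]
    (w : TransWord.{u, v} X) {a : Ordinal.{v}} (ha : a ≤ w.length + 1) (h0 : a ≠ 0) :
    ∃ p < a, ∀ q < a, ∀ L : List (Set X × Ordinal.{v}), (∀ P ∈ L, IsClosed P.1) →
      slice w q w.length le_rfl ∈ listProd L → slice w p w.length le_rfl ∈ listProd L := by
  rcases Ordinal.zero_or_succ_or_isSuccLimit a with h | ⟨b, rfl⟩ | hlim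
  · exact absurd h h0
  · have hb : b ≤ w.length := Order.lt_add_one_iff.mp ((Order.lt_succ b).trans_le ha)
    exact ⟨b, Order.lt_succ b, fun q hq L _ h =>
      slice_mem_listProd_of_le_left L (Order.lt_succ_iff.mp hq) hb le_rfl h⟩
  · have ha' : a ≤ w.length := by
      rcases ha.lt_or_eq with h | h
      · exact Order.lt_add_one_iff.mp h
      · exact absurd hlim (h ▸ Order.not_isSuccLimit_succ w.length)
    obtain ⟨p, hpa, hp⟩ := exists_stable_suffix_of_isSuccLimit w ha' hlim
    refine ⟨p, hpa, fun q hq L hL h => ?_⟩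
    rcases le_total p q with hpq | hpq
    · exact hp q hpq hq L hL h
    · exact slice_mem_listProd_of_le_left L hpq (hpa.le.trans ha') le_rfl h

/-! ### The regular subword topology is admissible -/

theorem isClosed_preimage_listProd [TopologicalSpace X] (Y : Set (TransWord.{u, v} X))
    {L : List (Set X × Ordinal.{v})} (hL : ∀ P ∈ L, IsClosed P.1) :
    IsClosed[regularSubwordTopology Y] ((Subtype.val : Y → TransWord.{u, v} X) ⁻¹' listProd L) := by
  let _ := regularSubwordTopology Y
  exact isOpen_compl_iff.mp (TopologicalSpace.isOpen_generateFrom_of_mem ⟨L, hL, rfl⟩)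

/-- In the regular subword topology, a word outside a closed set is separated from it by a finite
union of products. -/
theorem exists_finite_listProd_separating [TopologicalSpace X] {Y : Set (TransWord.{u, v} X)}
    {C : Set Y} (hC : IsClosed[regularSubwordTopology Y] C) {x : TransWord.{u, v} X}
    (hx : x ∈ Y) (hxC : x ∉ Subtype.val '' C) :
    ∃ K : Set (List (Set X × Ordinal.{v})), K.Finite ∧ (∀ L ∈ K, ∀ P ∈ L, IsClosed P.1) ∧
      (∀ y ∈ Subtype.val '' C, ∃ L ∈ K, y ∈ listProd L) ∧ ∀ L ∈ K, x ∉ listProd L := by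
  let _ := regularSubwordTopology Y
  have hx' : (⟨x, hx⟩ : Y) ∈ Cᶜ := fun h => hxC ⟨_, h, rfl⟩
  obtain ⟨_, ⟨f, ⟨hf, hfs⟩, rfl⟩, hxf, hfC⟩ :=
    (TopologicalSpace.isTopologicalBasis_of_subbasis rfl).exists_subset_of_mem_open hx'
      hC.isOpen_compl
  choose! g hg hgU using hfs
  refine ⟨g '' f, hf.image g, ?_, ?_, ?_⟩
  · rintro _ ⟨U, hU, rfl⟩
    exact hg hU
  · rintro _ ⟨y, hy, rfl⟩
    by_contra! hcon
    refine hfC (Set.mem_sInter.mpr fun U hU => ?_) hy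
    rw [hgU hU]
    exact hcon _ ⟨U, hU, rfl⟩
  · rintro _ ⟨U, hU, rfl⟩ hmem
    have := Set.mem_sInter.mp hxf U hU
    rw [hgU hU] at this
    exact this hmem

theorem mem_listProd_singleton {F : Set X} {γ : Ordinal.{v}} {w : TransWord.{u, v} X} :
    w ∈ listProd [(F, γ)] ↔ w ∈ powLT F γ := by
  rw [← slice_zero_length w, slice_mem_listProd_cons (zero_le (a := w.length)), slice_mem_powLT]
  constructor
  · rintro ⟨r, _, hr, hF, h⟩
    have h0 : w.length - r = 0 := congrArg length (show slice w r w.length le_rfl = empty from h)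
    obtain rfl : r = w.length := le_antisymm hr (Ordinal.sub_eq_zero_iff_le.mp h0)
    exact hF
  · intro hF
    exact ⟨w.length, zero_le (a := w.length), le_rfl, hF, slice_self w _ _⟩

theorem isAdmissible_regularSubwordTopology [TopologicalSpace X]
    [TopologicalSpace.NoetherianSpace X] (α : Ordinal.{v}) :
    IsAdmissible α (regularSubwordTopology (wordsLT.{u, v} X α)) where
  isClosed_powLT F γ hF _ := by
    have := isClosed_preimage_listProd (wordsLT.{u, v} X α) (L := [(F, γ)]) (by simpa using hF)
    convert this using 2
    ext w
    exact mem_listProd_singleton.symm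
  isClosed_catSet C₁ C₂ hC₁ hC₂ _ := by
    let _ := regularSubwordTopology (wordsLT.{u, v} X α)
    rw [← isOpen_compl_iff, isOpen_iff_forall_mem_open]
    rintro ⟨w, hw⟩ hwC
    have hsplit : ∀ r (hr : r ≤ w.length), slice w 0 r hr ∈ Subtype.val '' C₁ →
        slice w r w.length le_rfl ∉ Subtype.val '' C₂ := fun r hr h₁ h₂ => hwC <| by
      change w ∈ catSet _ _
      rw [← slice_zero_length w, slice_mem_catSet (zero_le (a := w.length))]
      exact ⟨r, zero_le (a := r), hr, h₁, h₂⟩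
    have hslice : ∀ p q (hq : q ≤ w.length), slice w p q hq ∈ wordsLT X α := fun p q hq =>
      (Ordinal.sub_le_self q p).trans_lt (hq.trans_lt hw)
    -- The trivial cover, for the cases where there is no cut to exclude.
    have hall : ∀ C : Set (wordsLT.{u, v} X α), ∀ y ∈ Subtype.val '' C,
        ∃ L ∈ ({[(Set.univ, α)]} : Set (List (Set X × Ordinal.{v}))), y ∈ listProd L := by
      rintro C _ ⟨y, _, rfl⟩
      exact ⟨_, rfl, mem_listProd_singleton.mpr ⟨y.2, fun _ => trivial⟩⟩
    have hallc : ∀ L ∈ ({[(Set.univ, α)]} : Set (List (Set X × Ordinal.{v}))),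
        ∀ P ∈ L, IsClosed P.1 := by
      rintro _ rfl P hP
      rw [List.mem_singleton.mp hP]
      exact isClosed_univ
    -- The value `w.length + 1` qualifies vacuously; it is the minimum when every prefix lies in
    -- `C₁`.
    obtain ⟨a, haS, hamin⟩ := wellFounded_lt.has_min
      {p : Ordinal.{v} | ∀ hp : p ≤ w.length, slice w 0 p hp ∉ Subtype.val '' C₁}
      ⟨w.length + 1, fun hp => absurd (Order.lt_add_one_iff.mpr le_rfl) (not_lt.mpr hp)⟩
    have han : a ≤ w.length + 1 := not_lt.mp <| hamin (w.length + 1)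
      fun hp => absurd (Order.lt_add_one_iff.mpr le_rfl) (not_lt.mpr hp)
    obtain ⟨K₁, hK₁f, hK₁c, hCK₁, hK₁⟩ : ∃ K₁ : Set (List (Set X × Ordinal.{v})), K₁.Finite ∧
        (∀ L ∈ K₁, ∀ P ∈ L, IsClosed P.1) ∧
        (∀ y ∈ Subtype.val '' C₁, ∃ L ∈ K₁, y ∈ listProd L) ∧
        ∀ p (hp : p ≤ w.length), a ≤ p → ∀ L ∈ K₁, slice w 0 p hp ∉ listProd L := by
      by_cases hal : a ≤ w.length
      · obtain ⟨K, hf, hc, hCK, hK⟩ :=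
          exists_finite_listProd_separating hC₁ (hslice 0 a hal) (haS hal)
        exact ⟨K, hf, hc, hCK, fun p hp hap L hL h => hK L hL
          (slice_mem_listProd_of_right_le L (zero_le (a := a)) hap hp h)⟩
      · exact ⟨_, Set.finite_singleton _, hallc, hall C₁, fun p hp hap => absurd (hap.trans hp) hal⟩
    obtain ⟨K₂, hK₂f, hK₂c, hCK₂, hK₂⟩ : ∃ K₂ : Set (List (Set X × Ordinal.{v})), K₂.Finite ∧
        (∀ L ∈ K₂, ∀ P ∈ L, IsClosed P.1) ∧
        (∀ y ∈ Subtype.val '' C₂, ∃ L ∈ K₂, y ∈ listProd L) ∧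
        ∀ p < a, ∀ L ∈ K₂, slice w p w.length le_rfl ∉ listProd L := by
      by_cases h0 : a = 0
      · exact ⟨_, Set.finite_singleton _, hallc, hall C₂,
          fun p hp => absurd hp (h0 ▸ not_lt.mpr (zero_le (a := p)))⟩
      · obtain ⟨p, hpa, hp⟩ := exists_stable_suffix w han h0
        obtain ⟨hpn, hp₁⟩ : ∃ hpn : p ≤ w.length, slice w 0 p hpn ∈ Subtype.val '' C₁ := by
          by_contra! hcon
          exact hamin p hcon hpa
        obtain ⟨K, hf, hc, hCK, hK⟩ := exists_finite_listProd_separating hC₂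
          (hslice p w.length le_rfl) (hsplit p hpn hp₁)
        exact ⟨K, hf, hc, hCK, fun q hq L hL h => hK L hL (hp q hq L (hc L hL) h)⟩
    refine ⟨(⋃ L₁ ∈ K₁, ⋃ L₂ ∈ K₂, Subtype.val ⁻¹' listProd (L₁ ++ L₂))ᶜ, ?_, ?_, ?_⟩
    · rw [Set.compl_subset_compl]
      rintro x ⟨a, ha, b, hb, hab⟩
      obtain ⟨L₁, hL₁, h₁⟩ := hCK₁ a ha
      obtain ⟨L₂, hL₂, h₂⟩ := hCK₂ b hb
      simp only [Set.mem_iUnion]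
      refine ⟨L₁, hL₁, L₂, hL₂, ?_⟩
      change x.1 ∈ listProd (L₁ ++ L₂)
      rw [hab, ← slice_zero_length (cat a b), slice_mem_listProd_append _ _
        (zero_le (a := (cat a b).length))]
      refine ⟨a.length, zero_le (a := a.length), le_self_add, ?_, ?_⟩
      · rwa [slice_cat_left]
      · rwa [slice_cat_right]
    · rw [isOpen_compl_iff]
      refine hK₁f.isClosed_biUnion fun L₁ hL₁ => hK₂f.isClosed_biUnion fun L₂ hL₂ =>
        isClosed_preimage_listProd _ fun P hP => ?_
      rcases List.mem_append.mp hP with h | h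
      exacts [hK₁c L₁ hL₁ P h, hK₂c L₂ hL₂ P h]
    · simp only [Set.mem_compl_iff, Set.mem_iUnion, not_exists]
      intro L₁ hL₁ L₂ hL₂ hmem
      change w ∈ listProd (L₁ ++ L₂) at hmem
      rw [← slice_zero_length w, slice_mem_listProd_append _ _ (zero_le (a := w.length))] at hmem
      obtain ⟨r, _, hr, h₁, h₂⟩ := hmem
      rcases lt_or_ge r a with h | h
      · exact hK₂ r h L₂ hL₂ h₂
      · exact hK₁ r hr h L₁ hL₁ h₁

/-! ### Every admissible topology is finer -/

/-- Two words concatenate to a word of length `< α`, for a bound `α`, essentially only if the first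
of them has length below the underlying power of `ω`. -/
theorem IsBound.exists_add_lt {α : Ordinal.{v}} (hα : IsBound α) :
    ∃ o, 0 < o ∧ o ≤ α ∧ (∀ a < o, ∀ b < α, a + b < α) ∧ ∀ a b, a + b < α → b = 0 ∨ a < o := by
  obtain ⟨β, rfl | rfl⟩ := hα
  · exact ⟨ω ^ β, Ordinal.opow_pos β Ordinal.omega0_pos, le_rfl,
      fun a ha b hb => Ordinal.isPrincipal_add_omega0_opow β ha hb,
      fun a b h => Or.inr (le_self_add.trans_lt h)⟩
  · refine ⟨ω ^ β, Ordinal.opow_pos β Ordinal.omega0_pos, le_self_add, fun a ha b hb => ?_,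
      fun a b h => ?_⟩
    · rw [Order.lt_add_one_iff] at hb ⊢
      exact (add_le_add_right hb a).trans_eq (Ordinal.add_omega0_opow ha)
    · rw [Order.lt_add_one_iff] at h
      refine or_iff_not_imp_left.mpr fun hb => ?_
      exact (lt_add_of_pos_right a (bot_lt_iff_ne_bot.mpr hb)).trans_le h

theorem cat_empty (w : TransWord.{u, v} X) : cat w empty = w :=
  ext_letter (add_zero _) fun _ _ hβ => dif_pos hβ

theorem IsAdmissible.isClosed_preimage_listProd [TopologicalSpace X] {α : Ordinal.{v}}
    (hα : IsBound α) {τ : TopologicalSpace (wordsLT.{u, v} X α)} (hτ : IsAdmissible α τ)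
    (L : List (Set X × Ordinal.{v})) (hL : ∀ P ∈ L, IsClosed P.1) :
    IsClosed[τ] ((Subtype.val : wordsLT.{u, v} X α → TransWord.{u, v} X) ⁻¹' listProd L) := by
  obtain ⟨o, ho, hoα, hadd, hsplit⟩ := hα.exists_add_lt
  induction L with
  | nil =>
    -- The empty product is `∅^{<1}`.
    convert hτ.isClosed_powLT ∅ 1 isClosed_empty
      (Order.one_le_iff_pos.mpr (ho.trans_le hoα)) using 2
    ext w
    constructor
    · rintro rfl
      exact empty_mem_powLT _ zero_lt_one
    · rintro ⟨h, -⟩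
      exact eq_empty_of_length_eq_zero (Order.lt_one_iff.mp h)
  | cons P L ih =>
    obtain ⟨F, γ⟩ := P
    have hF : IsClosed F := hL _ List.mem_cons_self
    have hpow : ∀ δ, IsClosed[τ]
        ((Subtype.val : wordsLT.{u, v} X α → TransWord.{u, v} X) ⁻¹' powLT F δ) := fun δ => by
      convert hτ.isClosed_powLT F (min δ α) hF (min_le_right _ _) using 1
      ext w
      exact ⟨fun h => ⟨lt_min h.1 w.2, h.2⟩, fun h => ⟨h.1.trans_le (min_le_left _ _), h.2⟩⟩
    -- Capping at `o` keeps all concatenations below `α`.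
    have hcat := hτ.isClosed_catSet _ _ (hpow (min γ o))
      (ih fun P hP => hL P (List.mem_cons_of_mem _ hP)) (by
        rintro _ ⟨_, ⟨a, ha, rfl⟩, _, ⟨b, -, rfl⟩, rfl⟩
        exact hadd _ (ha.1.trans_le (min_le_right _ _)) _ b.2)
    have hsub : ∀ w : wordsLT.{u, v} X α,
        w.1 ∈ catSet (Subtype.val '' ((Subtype.val : wordsLT.{u, v} X α → TransWord.{u, v} X) ⁻¹'
          powLT F (min γ o))) (Subtype.val ''
          ((Subtype.val : wordsLT.{u, v} X α → TransWord.{u, v} X) ⁻¹' listProd L)) →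
        w.1 ∈ listProd ((F, γ) :: L) := by
      rintro w ⟨_, ⟨a, ha, rfl⟩, _, ⟨b, hb, rfl⟩, hw⟩
      exact ⟨a, ⟨ha.1.trans_le (min_le_left _ _), ha.2⟩, b, hb, hw⟩
    have hcover : ∀ w : wordsLT.{u, v} X α, ∀ a ∈ powLT F γ, ∀ b ∈ listProd L, w.1 = cat a b →
        w.1 ∈ catSet (Subtype.val '' ((Subtype.val : wordsLT.{u, v} X α → TransWord.{u, v} X) ⁻¹'
          powLT F (min γ o))) (Subtype.val ''
          ((Subtype.val : wordsLT.{u, v} X α → TransWord.{u, v} X) ⁻¹' listProd L)) ∨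
        b = empty ∧ w.1 ∈ powLT F γ := by
      intro w a ha b hb hw
      have hlen : a.length + b.length < α := (congrArg length hw).symm.trans_lt w.2
      rcases hsplit _ _ hlen with h | h
      · obtain rfl := eq_empty_of_length_eq_zero h
        rw [hw, cat_empty]
        exact Or.inr ⟨rfl, ha⟩
      · exact Or.inl ⟨a, ⟨⟨a, h.trans_le hoα⟩, ⟨lt_min ha.1 h, ha.2⟩, rfl⟩, b,
          ⟨⟨b, le_add_self.trans_lt hlen⟩, hb, rfl⟩, hw⟩
    -- A first factor of length at least `o` forces an empty remainder, so `F^{<γ}` has to be added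
    -- exactly when `L` admits the empty word.
    by_cases he : (empty : TransWord.{u, v} X) ∈ listProd L
    · convert hcat.union (hpow γ) using 1
      ext w
      constructor
      · rintro ⟨a, ha, b, hb, hw⟩
        exact (hcover w a ha b hb hw).imp id And.right
      · rintro (h | h)
        · exact hsub w h
        · exact ⟨w, h, empty, he, (cat_empty _).symm⟩
    · convert hcat using 1
      ext w
      constructor
      · rintro ⟨a, ha, b, hb, hw⟩
        refine (hcover w a ha b hb hw).resolve_right ?_
        rintro ⟨rfl, -⟩
        exact he hb
      · exact hsub w

end TransWord

/-- In Mathlib's order on topologies `τ ≤ σ` means that `τ` is finer than `σ`, so that the greatest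
element of a set of topologies is the coarsest one. -/
theorem mainTheorem9 {X : Type u} [TopologicalSpace X] [TopologicalSpace.NoetherianSpace X]
    (α : Ordinal.{v}) (hα : TransWord.IsBound α) :
    IsGreatest {τ : TopologicalSpace (TransWord.wordsLT.{u, v} X α) | TransWord.IsAdmissible α τ}
      (TransWord.regularSubwordTopology (TransWord.wordsLT.{u, v} X α)) := by
  refine ⟨TransWord.isAdmissible_regularSubwordTopology α, fun τ hτ => ?_⟩
  refine le_generateFrom ?_
  rintro _ ⟨L, hL, rfl⟩
  exact (hτ.isClosed_preimage_listProd hα L hL).isOpen_compl
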